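/- Let $X=[0,1)$ and $X'=(0,1]$ be two disjoint copies of the indicated intervals, and let $\tilde X=X\sqcup X'$ be Alexandroff's ``two arrows'' space, with the topology whose base consists of all sets $$[\alpha,\beta)\cup(\alpha',\beta')\quad\text{and}\quad(\alpha,\beta)\cup(\alpha',\beta'],\qquad 0\le\alpha<\beta\le1,$$ where the first interval lies in $X$, the second one lies in $X'$, and both have the same endpoints $\alpha,\beta$. This space is compact. The commutative $C^*$-algebra $A=C(\tilde X)$ of continuous complex-valued functions on $\tilde X$, with the supremum norm, has the following properties. 1. $A$ is not separable. 2. $A$ is hereditarily projective: every closed left ideal of $A$ is projective in the category of left Banach $A$-modules. 3. $A$ is contained in $\mathcal B(H)$ for some separable complex Hilbert space $H$: there is an isometric unital $*$-homomorphism $A\to\mathcal B(H)$. In particular, there exists a nonseparable, hereditarily projective, commutative $C^*$-algebra contained in $\mathcal B(H)$ for a separable Hilbert space $H$. Here a left Banach $A$-module is a complex Banach space $Y$ with a bounded bilinear map $A\times Y\to Y$, $(a,y)\mapsto a\cdot y$, such that $(ab)\cdot y=a\cdot(b\cdot y)$; morphisms are the bounded linear maps that commute with the actions. A left Banach $A$-module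 $P$ is projective if, for each left Banach $A$-module $Y$ and each epimorphism of modules $\varphi:Y\to P$ that has a right inverse among the bounded linear maps, there is a morphism of modules $\psi:P\to Y$ with $\varphi\circ\psi=\mathrm{id}_P$. -/

import Mathlib

universe u v w

/-! ### Banach modules and projectivity -/

section BanachModules

/-- A left Banach module structure over a (not necessarily unital) complex normed algebra `A` on a
normed space `Y` (whose completeness is required separately): a jointly bounded bilinear
associative action. Even if `A` has an identity, it is not required to act as the identity. -/
structure LeftBanachModule (A : Type u) [NonUnitalNormedRing A] [NormedSpace ℂ A]
    (Y : Type v) [NormedAddCommGroup Y] [NormedSpace ℂ Y] where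
  /-- the action `a ↦ (y ↦ a · y)` -/
  act : A →L[ℂ] Y →L[ℂ] Y
  mul_act : ∀ (a b : A) (y : Y), act (a * b) y = act a (act b y)

/-- A bounded linear map is a morphism of left Banach `A`-modules if it commutes with the
actions. -/
def IsModuleMorphism {A : Type u} [NonUnitalNormedRing A] [NormedSpace ℂ A]
    {Y : Type v} [NormedAddCommGroup Y] [NormedSpace ℂ Y]
    {Z : Type w} [NormedAddCommGroup Z] [NormedSpace ℂ Z]
    (mY : LeftBanachModule A Y) (mZ : LeftBanachModule A Z) (f : Y →L[ℂ] Z) : Prop :=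
  ∀ (a : A) (y : Y), f (mY.act a y) = mZ.act a (f y)

/-- A left Banach `A`-module `P` is projective if every epimorphism of left Banach modules
`φ : Y → P` that has a right inverse `σ` among the bounded linear maps also has a right inverse
`ψ` among the module morphisms. (A `φ` with such a `σ` is surjective, hence an epimorphism.) -/
def LeftBanachModule.IsProjective {A : Type u} [NonUnitalNormedRing A] [NormedSpace ℂ A]
    {P : Type v} [NormedAddCommGroup P] [NormedSpace ℂ P] (mP : LeftBanachModule A P) : Prop :=
  ∀ (Y : Type w) [NormedAddCommGroup Y] [NormedSpace ℂ Y] [CompleteSpace Y]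
    (mY : LeftBanachModule A Y) (φ : Y →L[ℂ] P), IsModuleMorphism mY mP φ →
    (∃ σ : P →L[ℂ] Y, φ.comp σ = ContinuousLinearMap.id ℂ P) →
    ∃ ψ : P →L[ℂ] Y, IsModuleMorphism mP mY ψ ∧ φ.comp ψ = ContinuousLinearMap.id ℂ P

/-- The linear subspace `I` is a left ideal of the algebra `A`. -/
def IsLeftIdeal {A : Type u} [NonUnitalNormedRing A] [NormedSpace ℂ A]
    (I : Submodule ℂ A) : Prop :=
  ∀ a : A, ∀ x ∈ I, a * x ∈ I

/-- A left ideal of `A` as a left `A`-module, with the multiplication of `A` as the action. -/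
noncomputable def LeftBanachModule.ofLeftIdeal {A : Type u} [NonUnitalNormedRing A]
    [NormedSpace ℂ A] [IsScalarTower ℂ A A] [SMulCommClass ℂ A A]
    (I : Submodule ℂ A) (hI : IsLeftIdeal I) : LeftBanachModule A I where
  act := LinearMap.mkContinuous₂
    (LinearMap.mk₂ ℂ (fun (a : A) (x : I) => (⟨a * (x : A), hI a x x.2⟩ : I))
      (fun a b x => Subtype.ext (add_mul a b (x : A)))
      (fun c a x => Subtype.ext (smul_mul_assoc c a (x : A)))
      (fun a x y => Subtype.ext (mul_add a (x : A) (y : A)))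
      (fun c a x => Subtype.ext (mul_smul_comm c a (x : A))))
    1 (fun a x => by simpa using norm_mul_le a (x : A))
  mul_act a b x := Subtype.ext (mul_assoc a b (x : A))

/-- A Banach algebra is hereditarily projective if all its closed left ideals are projective left
Banach modules. -/
def IsHereditarilyProjective (A : Type u) [NonUnitalNormedRing A] [NormedSpace ℂ A]
    [IsScalarTower ℂ A A] [SMulCommClass ℂ A A] : Prop :=
  ∀ (I : Submodule ℂ A) (hI : IsLeftIdeal I), IsClosed (I : Set A) →
    LeftBanachModule.IsProjective.{u, u, w} (LeftBanachModule.ofLeftIdeal I hI)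

end BanachModules

/-! ### The two arrows space -/

/-- The underlying set of the two arrows space: the disjoint union of the lower interval
`X = [0, 1)` and the upper interval `X' = (0, 1]`. -/
inductive TwoArrows : Type
  | lower (x : Set.Ico (0 : ℝ) 1)
  | upper (x : Set.Ioc (0 : ℝ) 1)

namespace TwoArrows

/-- The set `[α, β) ∪ (α', β')`, with `[α, β)` in the lower and `(α', β')` in the upper
interval. -/
def lowerArrow (α β : ℝ) : Set TwoArrows :=
  lower '' {x | x.1 ∈ Set.Ico α β} ∪ upper '' {x | x.1 ∈ Set.Ioo α β}

/-- The set `(α, β) ∪ (α', β']`, with `(α, β)` in the lower and `(α', β']` in the upper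
interval. -/
def upperArrow (α β : ℝ) : Set TwoArrows :=
  lower '' {x | x.1 ∈ Set.Ioo α β} ∪ upper '' {x | x.1 ∈ Set.Ioc α β}

theorem lower_mem_lowerArrow {α β : ℝ} {x : Set.Ico (0 : ℝ) 1} :
    lower x ∈ lowerArrow α β ↔ α ≤ x.1 ∧ x.1 < β := by
  simp [lowerArrow]

theorem upper_mem_lowerArrow {α β : ℝ} {x : Set.Ioc (0 : ℝ) 1} :
    upper x ∈ lowerArrow α β ↔ α < x.1 ∧ x.1 < β := by
  simp [lowerArrow]

theorem lower_mem_upperArrow {α β : ℝ} {x : Set.Ico (0 : ℝ) 1} :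
    lower x ∈ upperArrow α β ↔ α < x.1 ∧ x.1 < β := by
  simp [upperArrow]

theorem upper_mem_upperArrow {α β : ℝ} {x : Set.Ioc (0 : ℝ) 1} :
    upper x ∈ upperArrow α β ↔ α < x.1 ∧ x.1 ≤ β := by
  simp [upperArrow]

/-- The base of the topology: all `lowerArrow α β` with `[α, β) ⊆ [0, 1)` and all
`upperArrow α β` with `(α, β] ⊆ (0, 1]`. -/
def base : Set (Set TwoArrows) :=
  {s | ∃ α β : ℝ, 0 ≤ α ∧ α < β ∧ β ≤ 1 ∧ (s = lowerArrow α β ∨ s = upperArrow α β)}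

instance : TopologicalSpace TwoArrows := TopologicalSpace.generateFrom base

/-- The family `base` is a base of the topology that it generates. -/
theorem isTopologicalBasis_base : TopologicalSpace.IsTopologicalBasis base := by
  refine ⟨?_, ?_, rfl⟩
  · rintro s ⟨a, b, ha, hab, hb, hs⟩ t ⟨c, d, hc, hcd, hd, ht⟩ p ⟨hp, hq⟩
    rcases p with ⟨x, hx0, hx1⟩ | ⟨x, hx0, hx1⟩
    · have hx : a ≤ x ∧ x < b ∧ c ≤ x ∧ x < d := by
        rcases hs with rfl | rfl <;> rcases ht with rfl | rfl <;>
          simp only [lower_mem_lowerArrow, upper_mem_lowerArrow,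
            lower_mem_upperArrow, upper_mem_upperArrow] at hp hq <;> grind
      refine ⟨lowerArrow x (min b d), ⟨x, min b d, hx0, lt_min hx.2.1 hx.2.2.2,
        (min_le_left _ _).trans hb, Or.inl rfl⟩, ?_, ?_⟩
      · simp [lower_mem_lowerArrow, hx.2.1, hx.2.2.2]
      · rintro (⟨y, hy0, hy1⟩ | ⟨y, hy0, hy1⟩) hy <;>
          rcases hs with rfl | rfl <;> rcases ht with rfl | rfl <;>
          simp only [lower_mem_lowerArrow, upper_mem_lowerArrow,
            lower_mem_upperArrow, upper_mem_upperArrow, Set.mem_inter_iff, lt_min_iff] at hp hq hy ⊢ <;>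
          grind
    · have hx : a < x ∧ x ≤ b ∧ c < x ∧ x ≤ d := by
        rcases hs with rfl | rfl <;> rcases ht with rfl | rfl <;>
          simp only [lower_mem_lowerArrow, upper_mem_lowerArrow,
            lower_mem_upperArrow, upper_mem_upperArrow] at hp hq <;> grind
      refine ⟨upperArrow (max a c) x, ⟨max a c, x, ha.trans (le_max_left _ _),
        max_lt hx.1 hx.2.2.1, hx1, Or.inr rfl⟩, ?_, ?_⟩
      · simp [upper_mem_upperArrow, hx.1, hx.2.2.1]
      · rintro (⟨y, hy0, hy1⟩ | ⟨y, hy0, hy1⟩) hy <;>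
          rcases hs with rfl | rfl <;> rcases ht with rfl | rfl <;>
          simp only [lower_mem_lowerArrow, upper_mem_lowerArrow,
            lower_mem_upperArrow, upper_mem_upperArrow, Set.mem_inter_iff, max_lt_iff] at hp hq hy ⊢ <;>
          grind
  · refine Set.eq_univ_of_forall fun p => ?_
    rcases p with ⟨x, hx0, hx1⟩ | ⟨x, hx0, hx1⟩
    · exact ⟨lowerArrow 0 1, ⟨0, 1, le_rfl, one_pos, le_rfl, Or.inl rfl⟩,
        lower_mem_lowerArrow.2 ⟨hx0, hx1⟩⟩
    · exact ⟨upperArrow 0 1, ⟨0, 1, le_rfl, one_pos, le_rfl, Or.inr rfl⟩,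
        upper_mem_upperArrow.2 ⟨hx0, hx1⟩⟩

/-- The two arrows space is compact, so that `C(TwoArrows, ℂ)` with the supremum norm is a
C*-algebra. -/
instance : CompactSpace TwoArrows := by
  refine ⟨isCompact_generateFrom rfl fun P hP hcov => ?_⟩
  let seg : ℝ → Set TwoArrows :=
    fun t => lower '' {x | x.1 < t} ∪ upper '' {x | x.1 ≤ t}
  have hl : ∀ t x, lower x ∈ seg t ↔ x.1 < t := fun t x => by simp [seg]
  have hu : ∀ t x, upper x ∈ seg t ↔ x.1 ≤ t := fun t x => by simp [seg]
  let T : Set ℝ := {t | t ∈ Set.Icc (0 : ℝ) 1 ∧ ∃ Q ⊆ P, Q.Finite ∧ seg t ⊆ ⋃₀ Q}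
  have h0 : (0 : ℝ) ∈ T := by
    refine ⟨⟨le_rfl, zero_le_one⟩, ∅, Set.empty_subset _, Set.finite_empty, ?_⟩
    rintro (⟨y, hy0, hy1⟩ | ⟨y, hy0, hy1⟩) hy <;>
      simp only [hl, hu] at hy <;> linarith
  have hbdd : BddAbove T := ⟨1, fun t ht => ht.1.2⟩
  have hc0 : 0 ≤ sSup T := le_csSup hbdd h0
  have hc1 : sSup T ≤ 1 := csSup_le ⟨0, h0⟩ fun t ht => ht.1.2
  have hcT : sSup T ∈ T := by
    rcases hc0.eq_or_lt with h | hpos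
    · rw [← h]; exact h0
    obtain ⟨s, hsP, hs⟩ := hcov (Set.mem_univ (upper ⟨sSup T, hpos, hc1⟩))
    obtain ⟨a, ha, hsub⟩ : ∃ a < sSup T, ∀ p ∈ seg (sSup T), p ∉ seg a → p ∈ s := by
      obtain ⟨a, b, ha, hab, hb, rfl | rfl⟩ := hP hsP <;>
      · simp only [upper_mem_lowerArrow, upper_mem_upperArrow] at hs
        refine ⟨(a + sSup T) / 2, by linarith, ?_⟩
        rintro (⟨y, hy0, hy1⟩ | ⟨y, hy0, hy1⟩) hy hy' <;>
          simp only [hl, hu, lower_mem_lowerArrow, upper_mem_lowerArrow,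
            lower_mem_upperArrow, upper_mem_upperArrow] at hy hy' ⊢ <;> grind
    obtain ⟨t, ⟨-, Q, hQP, hQ, hQs⟩, hat⟩ := exists_lt_of_lt_csSup ⟨0, h0⟩ ha
    refine ⟨⟨hc0, hc1⟩, insert s Q, Set.insert_subset hsP hQP, hQ.insert s, fun p hp => ?_⟩
    by_cases hpt : p ∈ seg t
    · obtain ⟨q, hq, hpq⟩ := hQs hpt
      exact ⟨q, Set.mem_insert_of_mem _ hq, hpq⟩
    · refine ⟨s, Set.mem_insert _ _, hsub p hp fun hpa => hpt ?_⟩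
      rcases p with y | y
      · exact (hl _ _).2 (((hl _ _).1 hpa).trans hat)
      · exact (hu _ _).2 (((hu _ _).1 hpa).trans hat.le)
  have hc : sSup T = 1 := by
    by_contra hne
    have hlt : sSup T < 1 := lt_of_le_of_ne hc1 hne
    obtain ⟨s, hsP, hs⟩ := hcov (Set.mem_univ (lower ⟨sSup T, hc0, hlt⟩))
    obtain ⟨t, hct, ht1, hsub⟩ :
        ∃ t > sSup T, t ≤ 1 ∧ ∀ p ∈ seg t, p ∉ seg (sSup T) → p ∈ s := by
      obtain ⟨a, b, ha, hab, hb, rfl | rfl⟩ := hP hsP <;>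
      · simp only [lower_mem_lowerArrow, lower_mem_upperArrow] at hs
        refine ⟨(sSup T + b) / 2, by linarith, by linarith, ?_⟩
        rintro (⟨y, hy0, hy1⟩ | ⟨y, hy0, hy1⟩) hy hy' <;>
          simp only [hl, hu, lower_mem_lowerArrow, upper_mem_lowerArrow,
            lower_mem_upperArrow, upper_mem_upperArrow] at hy hy' ⊢ <;> grind
    obtain ⟨-, Q, hQP, hQ, hQs⟩ := hcT
    refine absurd (le_csSup hbdd (show t ∈ T from ⟨⟨hc0.trans hct.le, ht1⟩, insert s Q,
      Set.insert_subset hsP hQP, hQ.insert s, fun p hp => ?_⟩)) (not_le.2 hct)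
    by_cases hpt : p ∈ seg (sSup T)
    · obtain ⟨q, hq, hpq⟩ := hQs hpt
      exact ⟨q, Set.mem_insert_of_mem _ hq, hpq⟩
    · exact ⟨s, Set.mem_insert _ _, hsub p hp hpt⟩
  rw [hc] at hcT
  obtain ⟨-, Q, hQP, hQ, hQs⟩ := hcT
  refine ⟨Q, hQP, hQ, fun p _ => hQs ?_⟩
  rcases p with y | y
  · exact (hl _ _).2 y.2.2
  · exact (hu _ _).2 y.2.2

end TwoArrows

/-! The initial segments `cut t` are clopen, and their characteristic functions form an uncountable
family with mutual distances at least 1, so the algebra is not separable. The space itself is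
separable, and multiplication by the values of a function along a dense sequence represents the
algebra isometrically on `ℓ²`.

For projectivity, every open `U` is a countable disjoint union of clopen sets `S i`
(`exists_clopen_partition`), and a closed ideal consists of the functions vanishing off some such
`U`. If `χ i` is the characteristic function of `S i` and `σ` a bounded linear right inverse of `φ`,
then `ψ f = ∑ i, (f * χ i) · σ (χ i)` is a module morphism with `φ (ψ f) = f`. Convergence is the
main point: averaging over signs (`norm_bilin_add_sum_le`) bounds each finite partial sum by the
supremum of `|f|` on the pieces involved, and `f` is small off finitely many pieces. -/

/-! ### Multiplication operators on sequence spaces -/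

section Diagonal

/-- The action of `C(X, ℂ)` on `ℓ²` by multiplication with the values along a sequence of
points. -/
noncomputable def ContinuousMap.diagonalCLM {X : Type*} [TopologicalSpace X] [CompactSpace X]
    (d : ℕ → X) (f : C(X, ℂ)) :
    lp (fun _ : ℕ => ℂ) 2 →L[ℂ] lp (fun _ : ℕ => ℂ) 2 :=
  lp.mapCLM 2 (fun n => ContinuousLinearMap.mul ℂ ℂ (f (d n))) (norm_nonneg f)
    (fun _ => (ContinuousLinearMap.opNorm_mul_apply_le ℂ ℂ _).trans (f.norm_coe_le_norm _))

@[simp]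
theorem ContinuousMap.diagonalCLM_apply {X : Type*} [TopologicalSpace X] [CompactSpace X]
    (d : ℕ → X) (f : C(X, ℂ)) (v : lp (fun _ : ℕ => ℂ) 2) (n : ℕ) :
    ContinuousMap.diagonalCLM d f v n = f (d n) * v n :=
  rfl

/-- `ContinuousMap.diagonalCLM` as a `*`-homomorphism. -/
noncomputable def ContinuousMap.diagonalStarAlgHom {X : Type*} [TopologicalSpace X]
    [CompactSpace X] (d : ℕ → X) :
    C(X, ℂ) →⋆ₐ[ℂ] (lp (fun _ : ℕ => ℂ) 2 →L[ℂ] lp (fun _ : ℕ => ℂ) 2) where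
  toFun := ContinuousMap.diagonalCLM d
  map_one' := by ext v n; simp
  map_mul' f g := by ext v n; simp [mul_assoc]
  map_zero' := by ext v n; simp
  map_add' f g := by ext v n; simp [add_mul]
  commutes' c := by ext v n; simp [Algebra.algebraMap_eq_smul_one]
  map_star' f := by
    rw [ContinuousLinearMap.star_eq_adjoint, ContinuousLinearMap.eq_adjoint_iff]
    intro v w
    rw [lp.inner_eq_tsum, lp.inner_eq_tsum]
    refine tsum_congr fun n => ?_
    simp
    ring

/-- The `n`-th basis vector is an eigenvector with eigenvalue `f (d n)`, so the operator norm
dominates `|f|` on a dense set. -/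
theorem ContinuousMap.isometry_diagonalStarAlgHom {X : Type*} [TopologicalSpace X]
    [CompactSpace X] {d : ℕ → X} (hd : DenseRange d) :
    Isometry (ContinuousMap.diagonalStarAlgHom d) := by
  refine AddMonoidHomClass.isometry_of_norm _ fun f => le_antisymm ?_ ?_
  · exact lp.norm_mapCLM_le 2 (fun n => ContinuousLinearMap.mul ℂ ℂ (f (d n))) (norm_nonneg f)
      fun _ => (ContinuousLinearMap.opNorm_mul_apply_le ℂ ℂ _).trans (f.norm_coe_le_norm _)
  · refine (ContinuousMap.norm_le f (norm_nonneg _)).2 fun x => ?_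
    refine hd.induction_on x (isClosed_le (by fun_prop) continuous_const) fun n => ?_
    have h := (ContinuousMap.diagonalStarAlgHom d f).le_opNorm (lp.single 2 n (1 : ℂ))
    rw [lp.norm_single (by norm_num), norm_one, mul_one] at h
    refine le_trans ?_ ((lp.norm_apply_le_norm (by norm_num) _ n).trans h)
    change _ ≤ ‖f (d n) * _‖
    simp

theorem lp.separableSpace_two :
    TopologicalSpace.SeparableSpace (lp (fun _ : ℕ => ℂ) 2) := by
  have hs : TopologicalSpace.IsSeparable
      ((Submodule.span ℂ (Set.range fun n : ℕ => lp.single (E := fun _ => ℂ) 2 n (1 : ℂ)) :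
        Submodule ℂ (lp (fun _ : ℕ => ℂ) 2)) : Set (lp (fun _ : ℕ => ℂ) 2)) :=
    (Set.countable_range _).isSeparable.span
  refine TopologicalSpace.isSeparable_univ_iff.1 (hs.closure.mono fun v _ => ?_)
  refine mem_closure_of_tendsto (lp.hasSum_single (by norm_num) v)
    (Filter.Eventually.of_forall fun s => Submodule.sum_mem _ fun n _ => ?_)
  have : lp.single (E := fun _ => ℂ) 2 n (v n) = v n • lp.single 2 n (1 : ℂ) := by
    rw [← lp.single_smul, smul_eq_mul, mul_one]
  rw [this]
  exact Submodule.smul_mem _ _ (Submodule.subset_span ⟨n, rfl⟩)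

theorem ContinuousMap.exists_isometry_separable_hilbertSpace (X : Type*) [TopologicalSpace X]
    [CompactSpace X] [TopologicalSpace.SeparableSpace X] [Nonempty X] :
    ∃ (H : Type) (_ : NormedAddCommGroup H) (_ : InnerProductSpace ℂ H) (_ : CompleteSpace H)
      (_ : TopologicalSpace.SeparableSpace H) (φ : C(X, ℂ) →⋆ₐ[ℂ] (H →L[ℂ] H)), Isometry φ :=
  ⟨lp (fun _ : ℕ => ℂ) 2, inferInstance, inferInstance, inferInstance, lp.separableSpace_two,
    ContinuousMap.diagonalStarAlgHom (TopologicalSpace.denseSeq X),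
    ContinuousMap.isometry_diagonalStarAlgHom (TopologicalSpace.denseRange_denseSeq X)⟩

end Diagonal

/-! ### Topology of the two arrows space -/

/-- Every set in a second countable linear order has a countable coinitial subset. -/
theorem exists_countable_coinitial {α : Type*} [LinearOrder α] [TopologicalSpace α]
    [OrderTopology α] [SecondCountableTopology α] (S : Set α) :
    ∃ T ⊆ S, T.Countable ∧ ∀ x ∈ S, ∃ t ∈ T, t ≤ x := by
  obtain ⟨D, hD, hDd⟩ := TopologicalSpace.exists_countable_dense S
  -- A dense subset of `S` has points below every `x ∈ S` that is not least; only a least element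
  -- may be missed, so it is added.
  refine ⟨(↑) '' D ∪ {m | IsLeast S m}, ?_, (hD.image _).union ?_, fun x hx => ?_⟩
  · rintro _ (⟨y, -, rfl⟩ | h)
    exacts [y.2, h.1]
  · exact Set.Subsingleton.countable fun a ha b hb => ha.unique hb
  · by_cases hm : IsLeast S x
    · exact ⟨x, Or.inr hm, le_rfl⟩
    · have : ∃ y ∈ S, y < x := by
        by_contra! h
        exact hm ⟨hx, h⟩
      obtain ⟨y, hy, hyx⟩ := this
      obtain ⟨z, hz, hzD⟩ := hDd.exists_mem_open
        (isOpen_Iio.preimage continuous_subtype_val : IsOpen {z : S | (z : α) < x}) ⟨⟨y, hy⟩, hyx⟩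
      exact ⟨z, Or.inl ⟨z, hz, rfl⟩, hzD.le⟩

theorem exists_countable_cofinal {α : Type*} [LinearOrder α] [TopologicalSpace α]
    [OrderTopology α] [SecondCountableTopology α] (S : Set α) :
    ∃ T ⊆ S, T.Countable ∧ ∀ x ∈ S, ∃ t ∈ T, x ≤ t :=
  exists_countable_coinitial (α := αᵒᵈ) S

namespace TwoArrows

/-- The initial segment `[0, t) ∪ (0', t']` of the two arrows space. -/
def cut (t : ℝ) : Set TwoArrows :=
  lower '' {x | x.1 < t} ∪ upper '' {x | x.1 ≤ t}

@[simp]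
theorem lower_mem_cut {t : ℝ} {x : Set.Ico (0 : ℝ) 1} : lower x ∈ cut t ↔ x.1 < t := by
  simp [cut]

@[simp]
theorem upper_mem_cut {t : ℝ} {x : Set.Ioc (0 : ℝ) 1} : upper x ∈ cut t ↔ x.1 ≤ t := by
  simp [cut]

theorem cut_mono : Monotone cut := by
  rintro s t h (x | x) hx
  · exact lower_mem_cut.2 ((lower_mem_cut.1 hx).trans_le h)
  · exact upper_mem_cut.2 ((upper_mem_cut.1 hx).trans h)

theorem isClopen_cut (t : ℝ) : IsClopen (cut t) := by
  constructor
  · rw [← isOpen_compl_iff, isTopologicalBasis_base.isOpen_iff]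
    rintro (⟨x, hx0, hx1⟩ | ⟨x, hx0, hx1⟩) hx <;>
      simp only [Set.mem_compl_iff, lower_mem_cut, upper_mem_cut, not_lt, not_le] at hx
    · refine ⟨lowerArrow x 1, ⟨x, 1, hx0, hx1, le_rfl, Or.inl rfl⟩,
        lower_mem_lowerArrow.2 ⟨le_rfl, hx1⟩, ?_⟩
      rintro (y | y) hy <;>
        simp only [lower_mem_lowerArrow, upper_mem_lowerArrow, Set.mem_compl_iff, lower_mem_cut,
          upper_mem_cut, not_lt, not_le] at hy ⊢ <;> linarith
    -- Here `t` may be negative, while basic sets need endpoints in `[0, 1]`.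
    · refine ⟨upperArrow (max t 0) x, ⟨max t 0, x, le_max_right _ _, max_lt hx hx0, hx1,
        Or.inr rfl⟩, upper_mem_upperArrow.2 ⟨max_lt hx hx0, le_rfl⟩, ?_⟩
      rintro (y | y) hy <;>
        simp only [lower_mem_upperArrow, upper_mem_upperArrow, Set.mem_compl_iff, lower_mem_cut,
          upper_mem_cut, not_lt, not_le, max_lt_iff] at hy ⊢ <;> linarith
  · rw [isTopologicalBasis_base.isOpen_iff]
    rintro (⟨x, hx0, hx1⟩ | ⟨x, hx0, hx1⟩) hx <;>
      simp only [lower_mem_cut, upper_mem_cut] at hx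
    · refine ⟨lowerArrow x (min t 1), ⟨x, min t 1, hx0, lt_min hx hx1, min_le_right _ _,
        Or.inl rfl⟩, lower_mem_lowerArrow.2 ⟨le_rfl, lt_min hx hx1⟩, ?_⟩
      rintro (y | y) hy <;>
        simp only [lower_mem_lowerArrow, upper_mem_lowerArrow, lower_mem_cut,
          upper_mem_cut, lt_min_iff] at hy ⊢ <;> linarith
    · refine ⟨upperArrow 0 x, ⟨0, x, le_rfl, hx0, hx1,
        Or.inr rfl⟩, upper_mem_upperArrow.2 ⟨hx0, le_rfl⟩, ?_⟩
      rintro (y | y) hy <;>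
        simp only [lower_mem_upperArrow, upper_mem_upperArrow, lower_mem_cut,
          upper_mem_cut] at hy ⊢ <;> linarith

instance : Nonempty TwoArrows := ⟨lower ⟨0, le_rfl, one_pos⟩⟩

/-- The delicate pair is the two copies of one point `y`: `cut y` contains the upper copy but not
the lower one. -/
theorem exists_cut_separating {p q : TwoArrows} (h : p ≠ q) :
    ∃ t, p ∈ cut t ∧ q ∉ cut t ∨ q ∈ cut t ∧ p ∉ cut t := by
  rcases p with x | x <;> rcases q with y | y <;>
    simp only [lower_mem_cut, upper_mem_cut, not_lt, not_le]
  · have : x.1 ≠ y.1 := fun e => h (congrArg lower (Subtype.ext e))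
    rcases lt_or_gt_of_ne this with h | h
    exacts [⟨y, Or.inl ⟨h, le_rfl⟩⟩, ⟨x, Or.inr ⟨h, le_rfl⟩⟩]
  · rcases lt_or_ge x.1 y.1 with h | h
    · obtain ⟨t, ht⟩ := exists_between h
      exact ⟨t, Or.inl ht⟩
    · exact ⟨y, Or.inr ⟨le_rfl, h⟩⟩
  · rcases lt_or_ge y.1 x.1 with h | h
    · obtain ⟨t, ht⟩ := exists_between h
      exact ⟨t, Or.inr ht⟩
    · exact ⟨x, Or.inl ⟨le_rfl, h⟩⟩
  · have : x.1 ≠ y.1 := fun e => h (congrArg upper (Subtype.ext e))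
    rcases lt_or_gt_of_ne this with h | h
    exacts [⟨x, Or.inl ⟨le_rfl, h⟩⟩, ⟨y, Or.inr ⟨le_rfl, h⟩⟩]

instance : T2Space TwoArrows := by
  refine ⟨fun p q h => ?_⟩
  obtain ⟨t, ⟨hp, hq⟩ | ⟨hq, hp⟩⟩ := exists_cut_separating h
  · exact ⟨cut t, (cut t)ᶜ, (isClopen_cut t).isOpen, (isClopen_cut t).compl.isOpen, hp, hq,
      disjoint_compl_right⟩
  · exact ⟨(cut t)ᶜ, cut t, (isClopen_cut t).compl.isOpen, (isClopen_cut t).isOpen, hp, hq,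
      disjoint_compl_left⟩

instance : TopologicalSpace.SeparableSpace TwoArrows := by
  let D : Set TwoArrows := lower '' {x | ∃ q : ℚ, (q : ℝ) = x.1}
  have hD : D.Countable := by
    refine Set.Countable.image ?_ _
    exact (Set.countable_range ((↑) : ℚ → ℝ)).preimage Subtype.val_injective
  refine ⟨D, hD, isTopologicalBasis_base.dense_iff.2 ?_⟩
  rintro s ⟨a, b, ha, hab, hb, hs⟩ -
  obtain ⟨q, haq, hqb⟩ := exists_rat_btwn hab
  refine ⟨lower ⟨q, ha.trans haq.le, hqb.trans_le hb⟩, ?_, _, ⟨q, rfl⟩, rfl⟩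
  rcases hs with rfl | rfl
  · exact lower_mem_lowerArrow.2 ⟨haq.le, hqb⟩
  · exact lower_mem_upperArrow.2 ⟨haq, hqb⟩

theorem exists_rat_cut_of_lower_mem {U : Set TwoArrows} (hU : IsOpen U)
    {x : Set.Ico (0 : ℝ) 1} (hx : lower x ∈ U) :
    ∃ q : ℚ, x.1 < q ∧ cut q \ cut x ⊆ U := by
  obtain ⟨s, ⟨a, b, ha, hab, hb, hs⟩, hxs, hsU⟩ := isTopologicalBasis_base.isOpen_iff.1 hU _ hx
  have hx' : a ≤ x.1 ∧ x.1 < b := by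
    rcases hs with rfl | rfl <;>
      simp only [lower_mem_lowerArrow, lower_mem_upperArrow] at hxs <;> grind
  obtain ⟨q, hxq, hqb⟩ := exists_rat_btwn hx'.2
  refine ⟨q, hxq, Set.Subset.trans ?_ hsU⟩
  rintro (y | y) ⟨h1, h2⟩ <;> rcases hs with rfl | rfl <;>
    simp only [lower_mem_lowerArrow, lower_mem_upperArrow, upper_mem_lowerArrow,
      upper_mem_upperArrow, lower_mem_cut, upper_mem_cut] at hxs h1 h2 ⊢ <;> grind

theorem exists_rat_cut_of_upper_mem {U : Set TwoArrows} (hU : IsOpen U)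
    {x : Set.Ioc (0 : ℝ) 1} (hx : upper x ∈ U) :
    ∃ q : ℚ, q < x.1 ∧ cut x \ cut q ⊆ U := by
  obtain ⟨s, ⟨a, b, ha, hab, hb, hs⟩, hxs, hsU⟩ := isTopologicalBasis_base.isOpen_iff.1 hU _ hx
  have hx' : a < x.1 ∧ x.1 ≤ b := by
    rcases hs with rfl | rfl <;>
      simp only [upper_mem_lowerArrow, upper_mem_upperArrow] at hxs <;> grind
  obtain ⟨q, haq, hqx⟩ := exists_rat_btwn hx'.1
  refine ⟨q, hqx, Set.Subset.trans ?_ hsU⟩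
  rintro (y | y) ⟨h1, h2⟩ <;> rcases hs with rfl | rfl <;>
    simp only [lower_mem_lowerArrow, lower_mem_upperArrow, upper_mem_lowerArrow,
      upper_mem_upperArrow, lower_mem_cut, upper_mem_cut] at hxs h1 h2 ⊢ <;> grind

/-- Each point of `U` lies in a one-sided clopen interval inside `U` whose far end is a rational
`q`. For fixed `q` these intervals form a chain in the other endpoint, so countably many of them
have the same union. -/
theorem exists_countable_clopen_cover {U : Set TwoArrows} (hU : IsOpen U) :
    ∃ 𝒞 : Set (Set TwoArrows), 𝒞.Countable ∧ (∀ s ∈ 𝒞, IsClopen s) ∧ ⋃₀ 𝒞 = U := by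
  choose T hTS hTc hT using fun q : ℚ =>
    exists_countable_coinitial {a : ℝ | cut q \ cut a ⊆ U}
  choose T' hTS' hTc' hT' using fun q : ℚ =>
    exists_countable_cofinal {a : ℝ | cut a \ cut q ⊆ U}
  refine ⟨⋃ q : ℚ, ((fun a => cut q \ cut a) '' T q ∪ (fun a => cut a \ cut q) '' T' q),
    Set.countable_iUnion fun q => ((hTc q).image _).union ((hTc' q).image _), ?_,
    Set.Subset.antisymm (Set.sUnion_subset ?_) ?_⟩
  · intro s hs
    obtain ⟨q, ⟨a, -, rfl⟩ | ⟨a, -, rfl⟩⟩ := Set.mem_iUnion.1 hs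
    exacts [(isClopen_cut _).diff (isClopen_cut _), (isClopen_cut _).diff (isClopen_cut _)]
  · intro s hs
    obtain ⟨q, ⟨a, ha, rfl⟩ | ⟨a, ha, rfl⟩⟩ := Set.mem_iUnion.1 hs
    exacts [hTS q ha, hTS' q ha]
  · rintro (x | x) hx
    · obtain ⟨q, hxq, hq⟩ := exists_rat_cut_of_lower_mem hU hx
      obtain ⟨t, ht, htx⟩ := hT q _ hq
      refine ⟨_, Set.mem_iUnion.2 ⟨q, Or.inl ⟨t, ht, rfl⟩⟩, ?_⟩
      simp [hxq, htx]
    · obtain ⟨q, hqx, hq⟩ := exists_rat_cut_of_upper_mem hU hx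
      obtain ⟨t, ht, htx⟩ := hT' q _ hq
      refine ⟨_, Set.mem_iUnion.2 ⟨q, Or.inr ⟨t, ht, rfl⟩⟩, ?_⟩
      simp [hqx, htx]

theorem exists_clopen_partition {U : Set TwoArrows} (hU : IsOpen U) :
    ∃ s : ℕ → Set TwoArrows, (∀ n, IsClopen (s n)) ∧ Pairwise (Function.onFun Disjoint s) ∧
      ⋃ n, s n = U := by
  obtain ⟨𝒞, hc, hcl, rfl⟩ := exists_countable_clopen_cover hU
  -- Inserting `∅` makes the family nonempty, hence the range of a sequence, even when `U` is empty.
  obtain ⟨f, hf⟩ := (hc.insert ∅).exists_eq_range (Set.insert_nonempty _ _)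
  have h : ∀ i, IsClopen (f i) := fun i => by
    have : f i ∈ insert ∅ 𝒞 := hf ▸ Set.mem_range_self i
    rcases this with h | h
    exacts [h ▸ isClopen_empty, hcl _ h]
  refine ⟨disjointed f, fun n => disjointedRec (fun t i ht => ht.diff (h i)) (h n),
    disjoint_disjointed f, ?_⟩
  rw [iUnion_disjointed, ← Set.sUnion_range, ← hf, Set.sUnion_insert, Set.empty_union]

theorem not_separableSpace_continuousMap :
    ¬ TopologicalSpace.SeparableSpace C(TwoArrows, ℂ) := by
  intro _
  let χ : ℝ → C(TwoArrows, ℂ) := fun t => LocallyConstant.charFn ℂ (isClopen_cut t)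
  have hχ : ∀ s t, s < t → s ∈ Set.Ico (0 : ℝ) 1 → 1 ≤ dist (χ s) (χ t) := by
    intro s t hst hs
    -- The lower copy of `s` belongs to `cut t` but not to `cut s`.
    refine le_trans ?_ (ContinuousMap.dist_apply_le_dist (lower ⟨s, hs⟩))
    simp [χ, LocallyConstant.coe_charFn, hst]
  have hd : (Set.Ico (0 : ℝ) 1).PairwiseDisjoint fun t => Metric.ball (χ t) (1 / 2) := by
    intro s hs t ht hst
    refine Metric.ball_disjoint_ball ?_
    rcases lt_or_gt_of_ne hst with h | h
    · linarith [hχ s t h hs]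
    · linarith [hχ t s h ht, dist_comm (χ s) (χ t)]
  have := hd.countable_of_isOpen (fun _ _ => Metric.isOpen_ball)
    fun t _ => ⟨χ t, Metric.mem_ball_self (by norm_num)⟩
  exact Cardinal.Real.Ico_countable_iff.1 this |>.not_gt one_pos

end TwoArrows

/-! ### Projectivity of ideals -/

/-- A bilinear map applied to a finite sum of elementary tensors can be averaged over signs. -/
theorem norm_bilin_add_sum_le {E F G ι : Type*} [NormedAddCommGroup E] [NormedSpace ℂ E]
    [NormedAddCommGroup F] [NormedSpace ℂ F] [NormedAddCommGroup G] [NormedSpace ℂ G]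
    (B : E →L[ℂ] F →L[ℂ] G) (a : ι → E) (b : ι → F) {C : ℝ} (s : Finset ι) (a₀ : E) (b₀ : F)
    (h : ∀ ε : ι → ℂ, (∀ i, ‖ε i‖ = 1) →
      ‖B (a₀ + ∑ i ∈ s, ε i • a i) (b₀ + ∑ i ∈ s, ε i • b i)‖ ≤ C) :
    ‖B a₀ b₀ + ∑ i ∈ s, B (a i) (b i)‖ ≤ C := by
  classical
  induction s using Finset.induction_on generalizing a₀ b₀ with
  | empty => simpa using h 1 (by simp)
  | insert j s hj ih =>
    -- The signed `j`-th terms are absorbed into `a₀` and `b₀`, which is why the induction keeps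
    -- these general.
    have key : ∀ c : ℂ, ‖c‖ = 1 →
        ‖B (a₀ + c • a j) (b₀ + c • b j) + ∑ i ∈ s, B (a i) (b i)‖ ≤ C := by
      intro c hc
      refine ih _ _ fun ε hε => ?_
      have h' := h (Function.update ε j c) fun i => by
        rcases eq_or_ne i j with rfl | hi
        · simpa
        · simpa [hi] using hε i
      rw [Finset.sum_insert hj, Finset.sum_insert hj, Function.update_self] at h'
      have e : ∀ i ∈ s, Function.update ε j c i = ε i := fun i hi =>
        Function.update_of_ne (ne_of_mem_of_not_mem hi hj) _ _
      have ea : ∑ i ∈ s, Function.update ε j c i • a i = ∑ i ∈ s, ε i • a i :=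
        Finset.sum_congr rfl fun i hi => by rw [e i hi]
      have eb : ∑ i ∈ s, Function.update ε j c i • b i = ∑ i ∈ s, ε i • b i :=
        Finset.sum_congr rfl fun i hi => by rw [e i hi]
      rw [ea, eb] at h'
      simpa only [add_assoc] using h'
    -- Averaging over `c = ±1` cancels the cross terms, linear in `c`, and keeps `B (a j) (b j)`
    -- since `c ^ 2 = 1`.
    have e : B a₀ b₀ + ∑ i ∈ insert j s, B (a i) (b i) =
        (1 / 2 : ℂ) • ((B (a₀ + (1 : ℂ) • a j) (b₀ + (1 : ℂ) • b j) + ∑ i ∈ s, B (a i) (b i)) +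
          (B (a₀ + (-1 : ℂ) • a j) (b₀ + (-1 : ℂ) • b j) + ∑ i ∈ s, B (a i) (b i))) := by
      rw [Finset.sum_insert hj]
      simp only [map_add, map_smul, add_apply, smul_apply]
      module
    rw [e, norm_smul, show ‖(1 / 2 : ℂ)‖ = 1 / 2 by norm_num]
    have h1 := key 1 (by simp)
    have h2 := key (-1) (by simp)
    have h3 := norm_add_le (B (a₀ + (1 : ℂ) • a j) (b₀ + (1 : ℂ) • b j) + ∑ i ∈ s, B (a i) (b i))
      (B (a₀ + (-1 : ℂ) • a j) (b₀ + (-1 : ℂ) • b j) + ∑ i ∈ s, B (a i) (b i))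
    linarith

/-- Multiples of `f` by the characteristic functions of disjoint clopen sets, added with signs. -/
theorem norm_sum_smul_mul_charFn_le {X ι : Type*} [TopologicalSpace X] [CompactSpace X]
    {S : ι → Set X} (hS : ∀ i, IsClopen (S i)) (hd : Pairwise (Function.onFun Disjoint S))
    (f : C(X, ℂ)) (ε : ι → ℂ) (hε : ∀ i, ‖ε i‖ = 1) (t : Finset ι) {C : ℝ} (hC : 0 ≤ C)
    (hf : ∀ i ∈ t, ∀ x ∈ S i, ‖f x‖ ≤ C) :
    ‖∑ i ∈ t, ε i • (f * (LocallyConstant.charFn ℂ (hS i) : C(X, ℂ)))‖ ≤ C := by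
  refine (ContinuousMap.norm_le _ hC).2 fun x => ?_
  rw [ContinuousMap.sum_apply]
  by_cases hx : ∃ j ∈ t, x ∈ S j
  · obtain ⟨j, hj, hxj⟩ := hx
    rw [Finset.sum_eq_single_of_mem j hj]
    · simpa [LocallyConstant.coe_charFn, hxj, hε] using hf j hj x hxj
    · intro i _ hij
      have : x ∉ S i := fun hxi => Set.disjoint_left.1 (hd hij) hxi hxj
      simp [LocallyConstant.coe_charFn, this]
  · rw [Finset.sum_eq_zero]
    · simpa
    · intro i hi
      have : x ∉ S i := fun hxi => hx ⟨i, hi, hxi⟩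
      simp [LocallyConstant.coe_charFn, this]

theorem LeftBanachModule.isProjective_ofLeftIdeal_of_clopen_partition {X : Type u} {ι : Type*}
    [TopologicalSpace X] [CompactSpace X] (I : Submodule ℂ C(X, ℂ)) (hI : IsLeftIdeal I)
    {S : ι → Set X} (hS : ∀ i, IsClopen (S i)) (hd : Pairwise (Function.onFun Disjoint S))
    (hIS : ∀ f : C(X, ℂ), f ∈ I ↔ ∀ x ∉ ⋃ i, S i, f x = 0) :
    LeftBanachModule.IsProjective.{u, u, w} (LeftBanachModule.ofLeftIdeal I hI) := by
  intro Y _ _ _ mY φ hφ ⟨σ, hσ⟩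
  let χ : ι → C(X, ℂ) := fun i => LocallyConstant.charFn ℂ (hS i)
  have hχ₁ : ∀ i x, x ∈ S i → χ i x = 1 := fun i x hx => by
    simp [χ, LocallyConstant.coe_charFn, hx]
  have hχ₀ : ∀ i x, x ∉ S i → χ i x = 0 := fun i x hx => by
    simp [χ, LocallyConstant.coe_charFn, hx]
  have hχI : ∀ i, χ i ∈ I := fun i => (hIS _).2 fun x hx =>
    hχ₀ i x fun h => hx (Set.mem_iUnion.2 ⟨i, h⟩)
  let e : ι → I := fun i => ⟨χ i, hχI i⟩
  let g : I → ι → Y := fun f i => mY.act (f.1 * χ i) (σ (e i))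
  -- The constant `C` bounds `f` only on the pieces in `t`; this yields both the small tails and,
  -- with `C = ‖f‖`, the boundedness of `ψ`.
  have hbound : ∀ (f : I) (t : Finset ι) (C : ℝ), 0 ≤ C → (∀ i ∈ t, ∀ x ∈ S i, ‖f.1 x‖ ≤ C) →
      ‖∑ i ∈ t, g f i‖ ≤ ‖mY.act‖ * C * ‖σ‖ := by
    intro f t C hC hf
    have := norm_bilin_add_sum_le mY.act (fun i => f.1 * χ i) (fun i => σ (e i))
      (C := ‖mY.act‖ * C * ‖σ‖) t 0 0 ?_
    · simpa [g] using this
    intro ε hε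
    simp only [zero_add]
    have h1 := norm_sum_smul_mul_charFn_le hS hd f.1 ε hε t hC hf
    have h2 := norm_sum_smul_mul_charFn_le hS hd 1 ε hε t zero_le_one (by simp)
    have h3 : ‖∑ i ∈ t, ε i • σ (e i)‖ ≤ ‖σ‖ * 1 := by
      simp only [← map_smul, ← map_sum]
      refine σ.le_opNorm_of_le ?_
      rw [Submodule.coe_norm]
      simpa [e, χ] using h2
    calc _ ≤ ‖mY.act‖ * ‖∑ i ∈ t, ε i • (f.1 * χ i)‖ * ‖∑ i ∈ t, ε i • σ (e i)‖ :=
          mY.act.le_opNorm₂ _ _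
      _ ≤ ‖mY.act‖ * C * (‖σ‖ * 1) := by gcongr
      _ = _ := by rw [mul_one]
  have hsum : ∀ f : I, Summable (g f) := by
    intro f
    refine summable_iff_vanishing_norm.2 fun δ hδ => ?_
    -- The summand 1 keeps `M` positive and makes the final estimate strict.
    set M := ‖mY.act‖ * ‖σ‖ + 1
    have hM : 0 < M := by positivity
    -- This compact set lies in the union of the `S i`, so finitely many pieces cover it; on every
    -- other piece `|f| < δ / M`.
    have hK : IsCompact {x | δ / M ≤ ‖f.1 x‖} :=
      (isClosed_le continuous_const f.1.continuous.norm).isCompact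
    obtain ⟨t, ht⟩ := hK.elim_finite_subcover S (fun i => (hS i).isOpen) fun x hx => by
      by_contra h
      rw [Set.mem_ofPred_eq, (hIS _).1 f.2 x h, norm_zero] at hx
      exact absurd hx (not_le.2 (by positivity))
    refine ⟨t, fun s hs => ?_⟩
    have := hbound f s (δ / M) (by positivity) fun i hi x hx => by
      by_contra! h
      obtain ⟨j, hj, hxj⟩ := Set.mem_iUnion₂.1 (ht h.le)
      have hij : i ≠ j := fun h => Finset.disjoint_left.1 hs hi (h ▸ hj)
      exact Set.disjoint_left.1 (hd hij) hx hxj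
    refine this.trans_lt ?_
    have : ‖mY.act‖ * (δ / M) * ‖σ‖ = δ * ((M - 1) / M) := by
      simp only [M]; ring
    rw [this]
    have : (M - 1) / M < 1 := (div_lt_one hM).2 (by linarith)
    nlinarith
  let ψ : I →L[ℂ] Y := LinearMap.mkContinuous
    { toFun := fun f => ∑' i, g f i
      map_add' := fun f f' => by
        rw [← (hsum f).tsum_add (hsum f')]
        simp [g, add_mul]
      map_smul' := fun c f => by
        rw [RingHom.id_apply, ← (hsum f).tsum_const_smul c]
        simp [g] } (‖mY.act‖ * ‖σ‖) fun f => by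
      refine le_of_tendsto (hsum f).hasSum.norm (Filter.Eventually.of_forall fun t => ?_)
      refine (hbound f t ‖f‖ (norm_nonneg _) fun i _ x _ => f.1.norm_coe_le_norm x).trans_eq ?_
      ring
  have hψ : ∀ f, ψ f = ∑' i, g f i := fun f => rfl
  refine ⟨ψ, fun a f => ?_, ?_⟩
  · rw [hψ, hψ, (mY.act a).map_tsum (hsum f)]
    refine tsum_congr fun i => ?_
    simp only [g, ← mY.mul_act, ← mul_assoc]
    rfl
  · ext f x
    have hφσ : ∀ y, φ (σ y) = y := fun y => DFunLike.congr_fun hσ y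
    have h1 : HasSum (fun i => φ (g f i)) (φ (ψ f)) := φ.hasSum (hsum f).hasSum
    have h2 : HasSum (fun i => (φ (g f i)).1 x) ((φ (ψ f)).1 x) :=
      h1.map (((ContinuousMap.evalCLM ℂ x).comp I.subtypeL)) (by fun_prop)
    -- One factor `χ i` comes from the acting element, the other from `φ (σ (e i)) = e i`.
    have h3 : ∀ i, (φ (g f i)).1 x = f.1 x * χ i x * χ i x := fun i => by
      simp only [g, hφ _ _, hφσ]
      rfl
    simp only [h3] at h2
    refine h2.unique ?_
    by_cases hx : x ∈ ⋃ i, S i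
    · obtain ⟨j, hj⟩ := Set.mem_iUnion.1 hx
      convert hasSum_single j fun i hij => ?_ using 1
      · simp [hχ₁ j x hj]
      · rw [hχ₀ i x fun hi => Set.disjoint_left.1 (hd hij) hi hj, mul_zero]
    · have : f.1 x = 0 := (hIS _).1 f.2 x hx
      simp [this, hasSum_zero]

/-- On a compact Hausdorff space a closed ideal is determined by the open set where some member is
nonzero. -/
theorem isHereditarilyProjective_of_clopen_partition {X : Type u} [TopologicalSpace X]
    [CompactSpace X] [T2Space X]
    (h : ∀ U : Set X, IsOpen U → ∃ S : ℕ → Set X, (∀ n, IsClopen (S n)) ∧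
      Pairwise (Function.onFun Disjoint S) ∧ ⋃ n, S n = U) :
    IsHereditarilyProjective.{u, w} C(X, ℂ) := by
  intro I hI hc
  let J : Ideal C(X, ℂ) := { I with smul_mem' := fun a x hx => hI a x hx }
  obtain ⟨S, hS, hd, hU⟩ := h _ (ContinuousMap.setOfIdeal_open J)
  refine LeftBanachModule.isProjective_ofLeftIdeal_of_clopen_partition I hI hS hd fun f => ?_
  rw [hU]
  change f ∈ J ↔ _
  -- The backward rewrite also replaces `J` inside `setOfIdeal` on the right; the last rewrite
  -- undoes that.
  rw [← ContinuousMap.idealOfSet_ofIdeal_isClosed (I := J) hc, ContinuousMap.mem_idealOfSet,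
    ContinuousMap.idealOfSet_ofIdeal_isClosed (I := J) hc]
  rfl

theorem mainTheorem12 :
    ¬ TopologicalSpace.SeparableSpace C(TwoArrows, ℂ) ∧
    IsHereditarilyProjective.{0, w} C(TwoArrows, ℂ) ∧
    ∃ (H : Type) (_ : NormedAddCommGroup H) (_ : InnerProductSpace ℂ H) (_ : CompleteSpace H)
      (_ : TopologicalSpace.SeparableSpace H) (φ : C(TwoArrows, ℂ) →⋆ₐ[ℂ] (H →L[ℂ] H)),
      Isometry φ :=
  ⟨TwoArrows.not_separableSpace_continuousMap,
    isHereditarilyProjective_of_clopen_partition fun _ hU => TwoArrows.exists_clopen_partition hU,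
    ContinuousMap.exists_isometry_separable_hilbertSpace TwoArrows⟩
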